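/- **Multiple Multicast Theorem.** An ADT network $G$ consists of a finite set $\mathcal V$ of supernodes, each supernode $V$ having finite sets $I(V)$ of input ports and $O(V)$ of output ports, together with a set $\mathcal E$ of edges, each going from an output port of one supernode to an input port of another. Assume that $G$ is acyclic, i.e. that the directed graph induced on the supernodes has no directed cycle. Let $\mathcal S,\mathcal T\subseteq\mathcal V$ be disjoint sets of sources and destinations. Each source $S\in\mathcal S$ has independent source processes $\mathcal X(S)=[X(S,1),\dots,X(S,\mu(S))]$ with symbols in a finite field; the other supernodes have none. Given a finite field $\mathbb K$ and coefficients $\alpha,\beta,\varepsilon$ in $\mathbb K$, the port symbols $Y$ are determined by $$Y(e')=\sum_{(e,e')\in\mathcal E}Y(e)\quad(e'\in I(V)),\qquad Y(e)=\sum_{e'\in I(V)}\beta_{(e',e)}Y(e')+\sum_{k=1}^{\mu(V)}\alpha_{(k,e)}X(V,k)\quad(e\in O(V)),$$ where $\mu(V)=0$ for $V\notin\mathcal S$; a destination $T$ forms the symbols $Z(T,i)=\sum_{e'\in I(T)}\varepsilon_{(e',(T,i))}Y(e')$. Let $\mathcal C=\{(S,T,\mathcal X(S)) : S\in\mathcal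 S,\ T\in\mathcal T\}$. The problem $(G,\mathcal C)$ is *solvable over $\mathbb K$* if the coefficients can be chosen in $\mathbb K$ so that, for all values of the source symbols, every $T\in\mathcal T$ reproduces all processes of all sources among its symbols $Z(T,i)$. Let $\mathbb F_q$ be a finite field. For a set $\Omega\subseteq\mathcal V$, let $G_\Omega$ be the $0$-$1$ incidence matrix over $\mathbb F_q$ whose rows are the output ports of supernodes in $\Omega$, whose columns are the input ports of supernodes outside $\Omega$, and whose entry at $(e,e')$ is $1$ iff $(e,e')\in\mathcal E$. Say that the *min-cut max-flow bound* holds if for every $T\in\mathcal T$ and every cut $\Omega\subseteq\mathcal V$ with $T\notin\Omega$ and $\Omega\cap\mathcal S\neq\emptyset$, $$\sum_{S\in\mathcal S\cap\Omega}\mu(S)\ \le\ \operatorname{rank}(G_\Omega).$$ Then: 1. $(G,\mathcal C)$ is solvable over some finite extension field of $\mathbb F_q$ if and only if the min-cut max-flow bound holds. 2. If $q>|\mathcal T|$, then $(G,\mathcal C)$ is solvable over $\mathbb F_q$ itself if and only if the min-cut max-flow bound holds. -/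

import Mathlib

universe u v

/-- A wireless network in the ADT model. Every supernode `v : V` has `numIn v` input ports and
`numOut v` output ports, and unit-capacity edges may join any output port to any input port. -/
structure ADTNetwork (V : Type*) where
  numIn : V → ℕ
  numOut : V → ℕ
  Edge : (Σ v, Fin (numOut v)) → (Σ v, Fin (numIn v)) → Prop

namespace ADTNetwork

/-- All input ports; the first component is the supernode that owns the port. -/
abbrev InPort {V : Type*} (G : ADTNetwork V) : Type _ := Σ v, Fin (G.numIn v)

/-- All output ports; the first component is the supernode that owns the port. -/
abbrev OutPort {V : Type*} (G : ADTNetwork V) : Type _ := Σ v, Fin (G.numOut v)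

/-- Some edge leads from an output port of `u` to an input port of `v`. -/
def Adj {V : Type*} (G : ADTNetwork V) (u v : V) : Prop :=
  ∃ (e : Fin (G.numOut u)) (e' : Fin (G.numIn v)), G.Edge ⟨u, e⟩ ⟨v, e'⟩

/-- There is no directed cycle of supernodes. -/
def IsAcyclic {V : Type*} (G : ADTNetwork V) : Prop :=
  ∀ v, ¬ Relation.TransGen G.Adj v v

open Classical in
/-- The incidence matrix `G_Ω`, over the field `F`, of the bipartite graph between the output ports
in `Ω` and the input ports outside `Ω`. -/
noncomputable def cutMatrix (F : Type*) [Field F] {V : Type*} (G : ADTNetwork V) (Ω : Finset V) :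
    Matrix {e : G.OutPort // e.1 ∈ Ω} {e' : G.InPort // e'.1 ∉ Ω} F :=
  Matrix.of fun e e' => if G.Edge e.1 e'.1 then 1 else 0

open Classical in
/-- The value `rank G_Ω` of the cut `Ω`. -/
noncomputable def cutValue (F : Type*) [Field F] {V : Type*} [Fintype V] (G : ADTNetwork V)
    (Ω : Finset V) : ℕ :=
  (G.cutMatrix F Ω).rank

open Classical in
/-- The min-cut max-flow bound for the destination `t`, where each source `s ∈ S` has rate `μ s`:
for every cut `Ω` with at least one source in `Ω` and with `t` outside `Ω`, the total rate of the
sources in `Ω`, all of which has to cross the cut, is at most the value of the cut. -/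
def SatisfiesCutBound (F : Type*) [Field F] {V : Type*} [Fintype V] (G : ADTNetwork V)
    (μ : V → ℕ) (S : Finset V) (t : V) : Prop :=
  ∀ Ω : Finset V, (∃ s ∈ S, s ∈ Ω) → t ∉ Ω → ∑ s ∈ S with s ∈ Ω, μ s ≤ G.cutValue F Ω

/-- A choice of the coding coefficients, where supernode `v` has the source processes
`X(v, k)`, `k : Fin (μ v)`. -/
structure LinearCode (F : Type*) {V : Type*} (G : ADTNetwork V) (μ : V → ℕ) where
  /-- The coefficient of the source process `X(v, k)` at the output port `j` of `v`. -/
  α : ∀ v, Fin (μ v) → Fin (G.numOut v) → F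
  /-- The coefficient of the input port `i` of `v` at the output port `j` of `v`. -/
  β : ∀ v, Fin (G.numIn v) → Fin (G.numOut v) → F
  /-- The decoding coefficient of the input port `i` of `t` in the process by which `t` reproduces
  the source process `p`. -/
  ε : ∀ t, Fin (G.numIn t) → (Σ v, Fin (μ v)) → F

open Classical in
/-- The symbols `yIn`, `yOut` at the ports obey the network equations for the source symbols `x`:
an input port receives the sum over its incoming edges, and an output port sends the prescribed
combination of the input ports and source processes of its supernode. -/
def LinearCode.Carries {F : Type*} [Field F] {V : Type*} [Fintype V] {G : ADTNetwork V}
    {μ : V → ℕ} (c : LinearCode F G μ) (x : (Σ v, Fin (μ v)) → F)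
    (yIn : G.InPort → F) (yOut : G.OutPort → F) : Prop :=
  (∀ e' : G.InPort, yIn e' = ∑ e : G.OutPort with G.Edge e e', yOut e) ∧
  (∀ (v : V) (j : Fin (G.numOut v)),
    yOut ⟨v, j⟩ = ∑ i, c.β v i j * yIn ⟨v, i⟩ + ∑ k, c.α v k j * x ⟨v, k⟩)

/-- The symbol that `t` generates in order to reproduce the source process `p`. -/
def LinearCode.decode {F : Type*} [Field F] {V : Type*} {G : ADTNetwork V} {μ : V → ℕ}
    (c : LinearCode F G μ) (yIn : G.InPort → F) (t : V) (p : Σ v, Fin (μ v)) : F :=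
  ∑ i, c.ε t i p * yIn ⟨t, i⟩

/-- A connection: `dst` has to reproduce the processes `procs` of `src`. -/
structure Connection {V : Type*} (μ : V → ℕ) where
  src : V
  dst : V
  procs : Finset (Fin (μ src))

/-- The network problem `(G, C)` is solvable over `F`: for some coding coefficients in `F`,
all connections in `C` are established for all values of the source symbols. -/
def Solvable (F : Type*) [Field F] {V : Type*} [Fintype V] (G : ADTNetwork V) (μ : V → ℕ)
    (C : Set (Connection μ)) : Prop :=
  ∃ c : LinearCode F G μ, ∀ x : (Σ v, Fin (μ v)) → F,
    (∃ yIn yOut, c.Carries x yIn yOut) ∧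
    ∀ yIn yOut, c.Carries x yIn yOut →
      ∀ a ∈ C, ∀ k ∈ a.procs, c.decode yIn a.dst ⟨a.src, k⟩ = x ⟨a.src, k⟩

/-- Every source in `S` multicasts all its processes to every destination in `T`. -/
def multipleMulticast {V : Type*} (μ : V → ℕ) (S T : Finset V) : Set (Connection μ) :=
  {a | a.src ∈ S ∧ a.dst ∈ T ∧ a.procs = Finset.univ}

end ADTNetwork

/-!
Assign a symbol to every source process and every output port, and view each output port as a gate
whose coding equation cuts out a hyperplane in the space of these states. A code is correct for a
destination `t` iff the coding equations kill all states in which `t` receives nothing.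

For such a code and a cut `Ω` that avoids `t`, consider the states that vanish outside `Ω`, at input
ports as well as at output ports. They satisfy the equations outside `Ω` trivially, so the equations
inside `Ω`, one per output port, have to kill all of them. They form a space of dimension
(rate of `Ω`) + (output ports of `Ω`) - `rank G_Ω`, so this forces the cut bound.

Conversely, over an infinite field one can choose the equations gate by gate so that each lowers
the dimension by one, except on the states where the gate sends and observes nothing. The cut bound
controls these exceptional states, so every destination admits a correct code. If a code is correct
for `t`, then at most one value of any single coefficient spoils it, since that coefficient enters
only one equation, and affinely. Hence the codes for the individual destinations can be merged
coefficient by coefficient with values in any prescribed set of more than `|T|` elements, for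
instance a subfield.
-/

theorem rank_map_algebraMap {m n F : Type*} (K : Type*) [Finite m] [Fintype n] [Field F] [Field K]
    [Algebra F K] (M : Matrix m n F) : (M.map (algebraMap F K)).rank = M.rank := by
  obtain ⟨b, hb, hspan, hli⟩ :=
    Submodule.exists_fun_fin_finrank_span_eq F (Set.range M.col)
  have hbK : LinearIndependent K fun i => algebraMap F K ∘ b i :=
    linearIndependent_algebraMap_comp_iff.2 hli
  have hspanK : Submodule.span K (Set.range (M.map (algebraMap F K)).col) =
      Submodule.span K (Set.range fun i => algebraMap F K ∘ b i) := by
    apply le_antisymm <;> rw [Submodule.span_le]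
    · rintro _ ⟨j, rfl⟩
      have hj : M.col j ∈ Submodule.span F (Set.range b) :=
        hspan.ge (Submodule.subset_span (Set.mem_range_self j))
      obtain ⟨c, hc⟩ := (Submodule.mem_span_range_iff_exists_fun F).1 hj
      refine (Submodule.mem_span_range_iff_exists_fun K).2 ⟨fun i => algebraMap F K (c i), ?_⟩
      ext i
      simpa [Algebra.smul_def] using congrArg (algebraMap F K) (congrFun hc i)
    · rintro _ ⟨i, rfl⟩
      obtain ⟨j, hj⟩ := hb i
      refine Submodule.subset_span ⟨j, ?_⟩
      simp only [← hj]
      rfl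
  rw [Matrix.rank_eq_finrank_span_cols, Matrix.rank_eq_finrank_span_cols, hspanK,
    finrank_span_eq_card hbK, Fintype.card_fin]

theorem exists_common_mem_of_subsingleton_line_compl {ι K τ : Type*} [Finite ι] [DecidableEq ι]
    [Fintype τ] (A : τ → Set (ι → K)) (Z : Finset K) (hZ : Fintype.card τ < Z.card)
    (hne : ∀ t, (A t).Nonempty)
    (hline : ∀ t, ∀ x ∈ A t, ∀ i, {z | Function.update x i z ∉ A t}.Subsingleton) :
    ∃ x : ι → K, (∀ i, x i ∈ Z) ∧ ∀ t, x ∈ A t := by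
  have move (x : τ → ι → K) (hx : ∀ t, x t ∈ A t) (i : ι) :
      ∃ z ∈ Z, ∀ t, Function.update (x t) i z ∈ A t := by
    by_contra! hbad
    have hτ : Nonempty τ := by
      obtain ⟨z, hz⟩ := Finset.card_pos.1 (Nat.zero_lt_of_lt hZ)
      exact ⟨(hbad z hz).choose⟩
    choose! bad hbad using hbad
    have hinj : Set.InjOn bad Z := fun z hz z' hz' h =>
      hline (bad z) _ (hx _) i (hbad z hz) (by rw [h]; exact hbad z' hz')
    exact hZ.not_ge (Finset.card_le_card_of_injOn bad (by simp) hinj)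
  have agree (s : Set ι) :
      ∃ x : τ → ι → K, (∀ t, x t ∈ A t) ∧ ∀ i ∈ s, ∃ z ∈ Z, ∀ t, x t i = z := by
    induction s, s.toFinite using Set.Finite.induction_on with
    | empty =>
      choose x hx using hne
      exact ⟨x, hx, by simp⟩
    | @insert i s his _ ih =>
      obtain ⟨x, hx, hxs⟩ := ih
      obtain ⟨z, hz, hzA⟩ := move x hx i
      refine ⟨fun t => Function.update (x t) i z, hzA, ?_⟩
      rintro k (rfl | hk)
      · exact ⟨z, hz, fun t => by simp⟩
      · obtain ⟨z', hz', h⟩ := hxs k hk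
        exact ⟨z', hz', fun t => by simp [ne_of_mem_of_not_mem hk his, h]⟩
  obtain ⟨x, hx, hxs⟩ := agree Set.univ
  choose z hz hzx using fun i => hxs i (Set.mem_univ i)
  refine ⟨z, hz, fun t => ?_⟩
  rw [← funext fun i => hzx i t]
  exact hx t

section Dual

variable {K W : Type*} [Field K] [AddCommGroup W] [Module K W]

theorem exists_sum_mul_eq_of_forall_eq_zero {ι : Type*} [Fintype ι] (P : Submodule K W)
    (f : ι → Module.Dual K W) (g : Module.Dual K W)
    (h : ∀ s ∈ P, (∀ i, f i s = 0) → g s = 0) :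
    ∃ c : ι → K, ∀ s ∈ P, ∑ i, c i * f i s = g s := by
  have hker : ⨅ i, LinearMap.ker ((f i).domRestrict P) ≤ LinearMap.ker (g.domRestrict P) := by
    rintro ⟨s, hs⟩ hfs
    exact h s hs (by simpa using hfs)
  obtain ⟨c, hc⟩ := (Submodule.mem_span_range_iff_exists_fun K).1
    (mem_span_of_iInf_ker_le_ker hker)
  exact ⟨c, fun s hs => by simpa using LinearMap.congr_fun hc ⟨s, hs⟩⟩

variable [FiniteDimensional K W]

theorem finrank_le_finrank_inf_ker_add_one (M : Submodule K W) (f : Module.Dual K W) :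
    Module.finrank K M ≤ Module.finrank K ↥(M ⊓ LinearMap.ker f) + 1 := by
  have hsum := Submodule.finrank_sup_add_finrank_inf_eq M (LinearMap.ker f)
  have hsup := (M ⊔ LinearMap.ker f).finrank_le
  have hker := f.finrank_range_add_finrank_ker
  have hrange := (LinearMap.range f).finrank_le
  rw [Module.finrank_self] at hrange
  omega

theorem finrank_le_finrank_inf_iInf_ker_add_card {E : Type*} (M : Submodule K W)
    (f : E → Module.Dual K W) (B : Finset E) :
    Module.finrank K M ≤ Module.finrank K ↥(M ⊓ ⨅ e ∈ B, LinearMap.ker (f e)) + B.card := by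
  classical
  induction B using Finset.induction_on with
  | empty => rw [Finset.card_empty, add_zero, iInf_eq_top.2 (by simp), inf_top_eq]
  | insert e B he ih =>
    have hstep := finrank_le_finrank_inf_ker_add_one (M ⊓ ⨅ e ∈ B, LinearMap.ker (f e)) (f e)
    rw [Finset.iInf_insert, Finset.card_insert_of_notMem he, inf_comm (LinearMap.ker (f e)),
      ← inf_assoc]
    omega

theorem le_of_finrank_le_of_lt_finrank_inf {M N : Submodule K W} {d : ℕ}
    (hM : Module.finrank K M ≤ d + 1) (hMN : d < Module.finrank K ↥(M ⊓ N)) : M ≤ N :=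
  inf_eq_left.1 <| Submodule.eq_of_le_of_finrank_le inf_le_left (by omega)

theorem subsingleton_lt_finrank_inf_ker_sub_smul (M : Submodule K W) (φ ψ : Module.Dual K W)
    {d : ℕ} {z₀ : K} (hz₀ : Module.finrank K ↥(M ⊓ LinearMap.ker (ψ - z₀ • φ)) ≤ d) :
    {z : K | d < Module.finrank K ↥(M ⊓ LinearMap.ker (ψ - z • φ))}.Subsingleton := by
  have hM : Module.finrank K M ≤ d + 1 :=
    (finrank_le_finrank_inf_ker_add_one M _).trans (Nat.succ_le_succ hz₀)
  intro z₁ hz₁ z₂ hz₂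
  by_contra hne
  refine hz₀.not_gt (lt_of_lt_of_le hz₁ (Submodule.finrank_mono (le_inf inf_le_left ?_)))
  rintro s ⟨hsM, -⟩
  have h₁ : ψ s - z₁ * φ s = 0 := le_of_finrank_le_of_lt_finrank_inf hM hz₁ hsM
  have h₂ : ψ s - z₂ * φ s = 0 := le_of_finrank_le_of_lt_finrank_inf hM hz₂ hsM
  have hφ : φ s = 0 := by
    have h : (z₁ - z₂) * φ s = 0 := by linear_combination h₂ - h₁
    exact (mul_eq_zero.1 h).resolve_left (sub_ne_zero.2 hne)
  simpa [hφ] using h₁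

theorem exists_finrank_inf_ker_sub_sum_le {ι : Type*} [Fintype ι] (M : Submodule K W)
    (π : Module.Dual K W) (a : ι → Module.Dual K W) {d : ℕ} (hM : Module.finrank K M ≤ d + 1)
    (hπa : Module.finrank K ↥(M ⊓ (LinearMap.ker π ⊓ ⨅ i, LinearMap.ker (a i))) ≤ d) :
    ∃ c : ι → K, Module.finrank K ↥(M ⊓ LinearMap.ker (π - ∑ i, c i • a i)) ≤ d := by
  classical
  by_contra! hc
  have hle (c : ι → K) : M ≤ LinearMap.ker (π - ∑ i, c i • a i) :=
    le_of_finrank_le_of_lt_finrank_inf hM (hc c)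
  have hπ : M ≤ LinearMap.ker π := by simpa using hle 0
  have ha (i : ι) : M ≤ LinearMap.ker (a i) := fun s hs => by
    have hi : π s - a i s = 0 := by simpa [Pi.single_apply] using hle (Pi.single i 1) hs
    rwa [show π s = 0 from hπ hs, zero_sub, neg_eq_zero] at hi
  refine (hc 0).not_ge (le_trans (Submodule.finrank_mono ?_) hπa)
  exact inf_le_left.trans (le_inf le_rfl (le_inf hπ (le_iInf ha)))

end Dual

/-- Output symbols, indexed by `E`, and the symbols that each of them may be computed from, all of
them given as linear functionals on one space `W`. -/
structure GateSystem (K W : Type*) [Field K] [AddCommGroup W] [Module K W] {E : Type*}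
    (ι : E → Type*) where
  out : E → Module.Dual K W
  obs : ∀ e, ι e → Module.Dual K W

namespace GateSystem

variable {K W E : Type*} {ι : E → Type*} [Field K] [AddCommGroup W] [Module K W]
  (g : GateSystem K W ι)

/-- The subspace on which the gates in `U` neither send nor observe anything. -/
def silent (U : Finset E) : Submodule K W :=
  ⨅ e ∈ U, LinearMap.ker (g.out e) ⊓ ⨅ i, LinearMap.ker (g.obs e i)

theorem silent_insert [DecidableEq E] (e : E) (U : Finset E) : g.silent (insert e U) =
    LinearMap.ker (g.out e) ⊓ (⨅ i, LinearMap.ker (g.obs e i)) ⊓ g.silent U :=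
  Finset.iInf_insert _ _ _

variable [∀ e, Fintype (ι e)]

/-- The defect of the coding equation of the gate `e`, for the coding coefficients `β`. -/
def codingForm (β : ∀ e, ι e → K) (e : E) : Module.Dual K W :=
  g.out e - ∑ i, β e i • g.obs e i

/-- The subspace on which the gates in `U` obey their coding equations. -/
def coded (β : ∀ e, ι e → K) (U : Finset E) : Submodule K W :=
  ⨅ e ∈ U, LinearMap.ker (g.codingForm β e)

theorem mem_coded {β : ∀ e, ι e → K} {U : Finset E} {s : W} :
    s ∈ g.coded β U ↔ ∀ e ∈ U, g.out e s = ∑ i, β e i * g.obs e i s := by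
  simp [coded, codingForm, sub_eq_zero]

section DecidableEq

variable [DecidableEq E]

theorem coded_insert (β : ∀ e, ι e → K) (e : E) (U : Finset E) :
    g.coded β (insert e U) = g.coded β U ⊓ LinearMap.ker (g.codingForm β e) := by
  rw [coded, Finset.iInf_insert, inf_comm, coded]

theorem coded_update_of_notMem (β : ∀ e, ι e → K) {e : E} {U : Finset E} (he : e ∉ U)
    (c : ι e → K) : g.coded (Function.update β e c) U = g.coded β U := by
  ext s
  simp only [mem_coded]
  refine forall₂_congr fun e' he' => ?_
  rw [Function.update_of_ne (ne_of_mem_of_not_mem he' he)]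

theorem codingForm_update_update [∀ e, DecidableEq (ι e)] (β : ∀ e, ι e → K) (e : E) (i : ι e)
    (z : K) :
    g.codingForm (Function.update β e (Function.update (β e) i z)) e =
      g.codingForm β e + β e i • g.obs e i - z • g.obs e i := by
  have hsum := Finset.add_sum_erase Finset.univ (fun j => β e j • g.obs e j) (Finset.mem_univ i)
  have hsum' := Finset.add_sum_erase Finset.univ
    (fun j => Function.update (β e) i z j • g.obs e j) (Finset.mem_univ i)
  have hrest : ∑ j ∈ Finset.univ.erase i, Function.update (β e) i z j • g.obs e j =
      ∑ j ∈ Finset.univ.erase i, β e j • g.obs e j :=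
    Finset.sum_congr rfl fun j hj => by rw [Function.update_of_ne (Finset.ne_of_mem_erase hj)]
  simp only [Function.update_self] at hsum'
  rw [codingForm, codingForm, Function.update_self, ← hsum, ← hsum', hrest]
  abel

theorem subsingleton_lt_finrank_inf_coded_update [FiniteDimensional K W]
    [∀ e, DecidableEq (ι e)] (N : Submodule K W) {d : ℕ} (U : Finset E) {β : ∀ e, ι e → K}
    (hβ : Module.finrank K ↥(N ⊓ g.coded β U) ≤ d) (e : E) (i : ι e) :
    {z : K | d < Module.finrank K
      ↥(N ⊓ g.coded (Function.update β e (Function.update (β e) i z)) U)}.Subsingleton := by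
  by_cases he : e ∈ U
  · have hsplit (c : ι e → K) : N ⊓ g.coded (Function.update β e c) U =
        N ⊓ g.coded β (U.erase e) ⊓ LinearMap.ker (g.codingForm (Function.update β e c) e) := by
      rw [inf_assoc, ← g.coded_update_of_notMem β (Finset.notMem_erase e U) c, ← coded_insert,
        Finset.insert_erase he]
    refine (subsingleton_lt_finrank_inf_ker_sub_smul (N ⊓ g.coded β (U.erase e)) (g.obs e i)
      (g.codingForm β e + β e i • g.obs e i) (d := d) (z₀ := β e i) ?_).anti fun z hz => ?_
    · rwa [← codingForm_update_update, ← hsplit, Function.update_eq_self, Function.update_eq_self]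
    · rwa [Set.mem_ofPred_eq, ← codingForm_update_update, ← hsplit]
  · intro z hz
    rw [Set.mem_ofPred_eq, g.coded_update_of_notMem β he] at hz
    exact absurd hβ hz.not_ge

end DecidableEq

variable [FiniteDimensional K W]

theorem exists_common_finrank_inf_coded_le [Finite E] {τ : Type*} [Fintype τ]
    (N : τ → Submodule K W) (d : τ → ℕ) (U : Finset E) (Z : Finset K)
    (hZ : Fintype.card τ < Z.card)
    (hex : ∀ t, ∃ β, Module.finrank K ↥(N t ⊓ g.coded β U) ≤ d t) :
    ∃ β, (∀ e i, β e i ∈ Z) ∧ ∀ t, Module.finrank K ↥(N t ⊓ g.coded β U) ≤ d t := by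
  classical
  let good (t : τ) : Set ((Σ e, ι e) → K) :=
    {x | Module.finrank K ↥(N t ⊓ g.coded (Sigma.curry x) U) ≤ d t}
  have hne (t : τ) : (good t).Nonempty :=
    let ⟨β, hβ⟩ := hex t
    ⟨Sigma.uncurry β, hβ⟩
  have hline (t : τ) (x) (hx : x ∈ good t) (p : Σ e, ι e) :
      {z | Function.update x p z ∉ good t}.Subsingleton := by
    refine (g.subsingleton_lt_finrank_inf_coded_update (N t) U hx p.1 p.2).anti fun z hz => ?_
    rwa [Set.mem_ofPred_eq, ← Sigma.curry_update, ← not_le]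
  obtain ⟨x, hxZ, hx⟩ := exists_common_mem_of_subsingleton_line_compl good Z hZ hne hline
  exact ⟨Sigma.curry x, fun e i => hxZ ⟨e, i⟩, hx⟩

theorem exists_finrank_inf_coded_le [Finite E] [DecidableEq E] [Infinite K] (N : Submodule K W)
    (d : ℕ) (U : Finset E)
    (hN : ∀ Ω ⊆ U, Module.finrank K ↥(N ⊓ g.silent (U \ Ω)) ≤ d + Ω.card) :
    ∃ β, Module.finrank K ↥(N ⊓ g.coded β U) ≤ d := by
  induction U using Finset.induction_on generalizing N d with
  | empty =>
    have h := hN ∅ le_rfl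
    rw [Finset.sdiff_self, silent, iInf_eq_top.2 (by simp)] at h
    exact ⟨fun _ _ => 0, by rwa [coded, iInf_eq_top.2 (by simp)]⟩
  | insert e U he ih =>
    -- If no choice for `e` lowers the bound from `d + 1` to `d`, then the space is quiet at `e`. So
    -- the other gates have to achieve `d + 1` on `N` and `d` on its quiet part simultaneously.
    set quiet := LinearMap.ker (g.out e) ⊓ ⨅ i, LinearMap.ker (g.obs e i) with hquiet
    have hcoded : ∃ β, Module.finrank K ↥(N ⊓ g.coded β U) ≤ d + 1 := by
      refine ih N (d + 1) fun Ω hΩ => ?_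
      have h := hN (insert e Ω) (Finset.insert_subset_insert e hΩ)
      rw [Finset.insert_sdiff_of_mem _ (Finset.mem_insert_self e Ω), Finset.sdiff_insert,
        Finset.erase_eq_of_notMem fun h => he (Finset.mem_sdiff.1 h).1,
        Finset.card_insert_of_notMem fun h => he (hΩ h)] at h
      omega
    have hsilent : ∃ β, Module.finrank K ↥(N ⊓ quiet ⊓ g.coded β U) ≤ d := by
      refine ih _ d fun Ω hΩ => ?_
      have h := hN Ω (hΩ.trans (Finset.subset_insert e U))
      rwa [Finset.insert_sdiff_of_notMem _ fun h => he (hΩ h), silent_insert, ← hquiet,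
        ← inf_assoc] at h
    obtain ⟨Z, hZ⟩ := Infinite.exists_subset_card_eq K 3
    obtain ⟨β, -, hβ⟩ := g.exists_common_finrank_inf_coded_le
      (fun b : Bool => cond b N (N ⊓ quiet)) (fun b => cond b (d + 1) d) U Z
      (by simp [hZ]) (Bool.forall_bool.2 ⟨hsilent, hcoded⟩)
    have hquietβ : Module.finrank K ↥(N ⊓ g.coded β U ⊓ quiet) ≤ d := by
      rw [inf_right_comm]
      exact hβ false
    obtain ⟨c, hc⟩ := exists_finrank_inf_ker_sub_sum_le _ _ _ (hβ true) hquietβ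
    refine ⟨Function.update β e c, ?_⟩
    rwa [coded_insert, g.coded_update_of_notMem β he, ← inf_assoc, codingForm,
      Function.update_self]

end GateSystem

theorem extend_val_eq_of_forall_not {α K : Type*} [Zero K] {p : α → Prop} {f : α → K}
    (hf : ∀ a, ¬ p a → f a = 0) :
    Function.extend (Subtype.val : Subtype p → α) (fun a => f a) 0 = f := by
  ext a
  by_cases ha : p a
  · exact Subtype.val_injective.extend_apply _ _ (⟨a, ha⟩ : Subtype p)
  · rw [Function.extend_apply' _ _ _ (by simpa using ha), hf a ha, Pi.zero_apply]

theorem card_sigma_fin_subtype {V : Type*} (n : V → ℕ) (Ω : Finset V)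
    [Fintype {p : Σ v, Fin (n v) // p.1 ∈ Ω}] :
    Fintype.card {p : Σ v, Fin (n v) // p.1 ∈ Ω} = ∑ v ∈ Ω, n v := by
  rw [Fintype.card_of_subtype (Ω.sigma fun _ => Finset.univ) (by simp), Finset.card_sigma]
  simp

namespace ADTNetwork

theorem IsAcyclic.wellFounded {V : Type*} [Finite V] {G : ADTNetwork V} (hG : G.IsAcyclic) :
    WellFounded G.Adj := by
  have : Std.Irrefl (Relation.TransGen G.Adj) := ⟨hG⟩
  exact Subrelation.wf (fun h => Relation.TransGen.single h)
    (Finite.wellFounded_of_trans_of_irrefl (Relation.TransGen G.Adj))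

section State

variable (K : Type*) {V : Type*} [Field K] [Fintype V] (G : ADTNetwork V) (μ : V → ℕ)

open Classical in
/-- The symbols at the input ports, as a function of those at the output ports. -/
noncomputable def inMap : (G.OutPort → K) →ₗ[K] (G.InPort → K) :=
  LinearMap.pi fun e' => ∑ e : G.OutPort with G.Edge e e', LinearMap.proj e

/-- A state of the network: the symbols of the source processes and of the output ports. -/
abbrev State : Type _ := ((Σ v, Fin (μ v)) → K) × (G.OutPort → K)

/-- The output ports as gates that observe the input ports and the source processes of their
supernode. -/
noncomputable def gates :
    GateSystem K (G.State K μ) fun e : G.OutPort => Fin (G.numIn e.1) ⊕ Fin (μ e.1) where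
  out e := LinearMap.proj e ∘ₗ LinearMap.snd K _ _
  obs e := Sum.elim
    (fun i => LinearMap.proj (⟨e.1, i⟩ : G.InPort) ∘ₗ G.inMap K ∘ₗ LinearMap.snd K _ _)
    (fun k => LinearMap.proj (⟨e.1, k⟩ : Σ v, Fin (μ v)) ∘ₗ LinearMap.fst K _ _)

/-- The states in which only the sources of `S` that lie in the cut `Ω` are active and in which
the output ports outside `Ω` and the input ports outside `Ω` carry the symbol `0`. -/
noncomputable def cutSpace (S Ω : Finset V) : Submodule K (G.State K μ) :=
  (Submodule.pi {p | p.1 ∈ S → p.1 ∉ Ω} fun _ => ⊥).prod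
    (Submodule.pi {e | e.1 ∉ Ω} (fun _ => ⊥) ⊓
      (Submodule.pi {e' | e'.1 ∉ Ω} fun _ => ⊥).comap (G.inMap K))

variable {K G μ}

theorem mem_cutSpace {S Ω : Finset V} {s : G.State K μ} :
    s ∈ G.cutSpace K μ S Ω ↔ (∀ p, (p.1 ∈ S → p.1 ∉ Ω) → s.1 p = 0) ∧
      (∀ e, e.1 ∉ Ω → s.2 e = 0) ∧ ∀ e', e'.1 ∉ Ω → G.inMap K s.2 e' = 0 := by
  simp [cutSpace, Submodule.mem_pi]

theorem mem_silent_gates {U : Finset G.OutPort} {s : G.State K μ} :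
    s ∈ (G.gates K μ).silent U ↔ ∀ e ∈ U, s.2 e = 0 ∧
      (∀ i, G.inMap K s.2 ⟨e.1, i⟩ = 0) ∧ ∀ k, s.1 ⟨e.1, k⟩ = 0 := by
  simp [GateSystem.silent, gates, Sum.forall]

open Classical in
theorem inMap_apply (y : G.OutPort → K) (e' : G.InPort) :
    G.inMap K y e' = ∑ e : G.OutPort with G.Edge e e', y e := by
  simp [inMap]

theorem inMap_eq_zero_of_adj {y : G.OutPort → K} {e' : G.InPort}
    (h : ∀ e : G.OutPort, G.Adj e.1 e'.1 → y e = 0) : G.inMap K y e' = 0 := by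
  classical
  rw [inMap_apply]
  exact Finset.sum_eq_zero fun e he => h e ⟨e.2, e'.2, (Finset.mem_filter.1 he).2⟩

theorem map_inMap {L : Type*} [Field L] (f : K →+* L) (y : G.OutPort → K) (e' : G.InPort) :
    f (G.inMap K y e') = G.inMap L (f ∘ y) e' := by
  classical
  simp only [inMap_apply, map_sum, Function.comp_apply]

open Classical in
theorem inMap_extend {Ω : Finset V} (y : {e : G.OutPort // e.1 ∈ Ω} → K)
    (e' : {e' : G.InPort // e'.1 ∉ Ω}) :
    G.inMap K (Function.extend Subtype.val y 0) e' = (G.cutMatrix K Ω).transpose.mulVec y e' := by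
  rw [inMap_apply, Finset.sum_filter, Matrix.mulVec, dotProduct]
  refine (Fintype.sum_of_injective _ Subtype.val_injective _ _ (fun e he => ?_) fun e => ?_).symm
  · rw [Function.extend_apply' _ _ _ he, Pi.zero_apply, ite_self]
  · simp [cutMatrix]

open Classical in
theorem finrank_cutSpace (S Ω : Finset V) :
    Module.finrank K (G.cutSpace K μ S Ω) + G.cutValue K Ω =
      ∑ v ∈ S with v ∈ Ω, μ v + ∑ v ∈ Ω, G.numOut v := by
  let M := (G.cutMatrix K Ω).transpose.mulVecLin
  let extProc := Function.ExtendByZero.linearMap K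
    (Subtype.val : {p : Σ v, Fin (μ v) // p.1 ∈ S.filter (· ∈ Ω)} → _)
  let extOut := Function.ExtendByZero.linearMap K (Subtype.val : {e : G.OutPort // e.1 ∈ Ω} → _)
  let ext := extProc.prodMap (extOut ∘ₗ (LinearMap.ker M).subtype)
  have hextProc : Function.Injective extProc :=
    Function.extend_injective Subtype.val_injective (0 : (Σ v, Fin (μ v)) → K)
  have hextOut : Function.Injective extOut :=
    Function.extend_injective Subtype.val_injective (0 : G.OutPort → K)
  have hinj : Function.Injective ext :=
    hextProc.prodMap (hextOut.comp (LinearMap.ker M).subtype_injective)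
  have hrange : LinearMap.range ext = G.cutSpace K μ S Ω := by
    ext ⟨x, y⟩
    rw [mem_cutSpace]
    constructor
    · rintro ⟨⟨x, y, hMy⟩, h⟩
      obtain ⟨rfl, rfl⟩ := Prod.ext_iff.1 h
      refine ⟨fun p hp => Function.extend_apply' _ _ _ (by simpa using hp),
        fun e he => Function.extend_apply' _ _ _ (by simpa using he), fun e' he' => ?_⟩
      exact (inMap_extend y ⟨e', he'⟩).trans (congrFun hMy ⟨e', he'⟩)
    · rintro ⟨hx, hy, hin⟩
      have hy' := extend_val_eq_of_forall_not hy
      refine ⟨⟨fun p => x p, fun e => y e, ?_⟩, Prod.ext ?_ hy'⟩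
      · ext e'
        refine (inMap_extend _ e').symm.trans ?_
        rw [hy']
        exact hin e' e'.2
      · exact extend_val_eq_of_forall_not fun p hp => hx p (by simpa using hp)
  have hrank : G.cutValue K Ω + Module.finrank K (LinearMap.ker M) = ∑ v ∈ Ω, G.numOut v := by
    rw [cutValue, ← Matrix.rank_transpose, ← card_sigma_fin_subtype,
      ← Module.finrank_fintype_fun_eq_card K]
    exact M.finrank_range_add_finrank_ker
  rw [← hrange, LinearMap.finrank_range_of_inj hinj, Module.finrank_prod,
    Module.finrank_fintype_fun_eq_card, card_sigma_fin_subtype μ, ← hrank]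
  omega

end State

section BaseChange

variable {V : Type*} [Fintype V] (G : ADTNetwork V) (F K : Type*) [Field F] [Field K] [Algebra F K]

theorem cutValue_eq_of_algebra (Ω : Finset V) : G.cutValue K Ω = G.cutValue F Ω := by
  classical
  have hmap : G.cutMatrix K Ω = (G.cutMatrix F Ω).map (algebraMap F K) := by
    ext e e'
    simp [cutMatrix, apply_ite (algebraMap F K)]
  rw [cutValue, cutValue, hmap, rank_map_algebraMap]

theorem satisfiesCutBound_iff_of_algebra (μ : V → ℕ) (S : Finset V) (t : V) :
    G.SatisfiesCutBound K μ S t ↔ G.SatisfiesCutBound F μ S t := by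
  simp only [SatisfiesCutBound, G.cutValue_eq_of_algebra F K]

end BaseChange

section Code

variable {K V : Type*} [Field K] [Fintype V] {G : ADTNetwork V} {μ : V → ℕ}

theorem mem_coded_gates {β : ∀ e : G.OutPort, Fin (G.numIn e.1) ⊕ Fin (μ e.1) → K}
    {U : Finset G.OutPort} {s : G.State K μ} :
    s ∈ (G.gates K μ).coded β U ↔ ∀ e ∈ U, s.2 e =
      ∑ i, β e (Sum.inl i) * G.inMap K s.2 ⟨e.1, i⟩ + ∑ k, β e (Sum.inr k) * s.1 ⟨e.1, k⟩ := by
  simp [GateSystem.mem_coded, gates]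

namespace LinearCode

/-- The coding coefficients of the output ports of a code, as gates. -/
def coeff (c : LinearCode K G μ) (e : G.OutPort) : Fin (G.numIn e.1) ⊕ Fin (μ e.1) → K :=
  Sum.elim (fun i => c.β e.1 i e.2) fun k => c.α e.1 k e.2

/-- The states of the network that obey all coding equations of a code. -/
noncomputable def states (c : LinearCode K G μ) : Submodule K (G.State K μ) :=
  (G.gates K μ).coded c.coeff Finset.univ

theorem carries_iff (c : LinearCode K G μ) (x : (Σ v, Fin (μ v)) → K) (yIn : G.InPort → K)
    (yOut : G.OutPort → K) :
    c.Carries x yIn yOut ↔ yIn = G.inMap K yOut ∧ (x, yOut) ∈ c.states := by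
  simp only [Carries, ← inMap_apply, ← funext_iff (f := yIn)]
  refine and_congr_right fun h => ?_
  simp [h, states, mem_coded_gates, coeff, Sigma.forall]

theorem eq_zero_of_mem_states (hG : G.IsAcyclic) {c : LinearCode K G μ} {s : G.State K μ}
    (hs : s ∈ c.states) (hs₁ : s.1 = 0) : s = 0 := by
  have hout (v : V) : ∀ j, s.2 ⟨v, j⟩ = 0 := by
    induction v using hG.wellFounded.induction with
    | _ v ih =>
      have hin (i : Fin (G.numIn v)) : G.inMap K s.2 ⟨v, i⟩ = 0 :=
        inMap_eq_zero_of_adj fun e he => ih e.1 he e.2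
      intro j
      rw [mem_coded_gates.1 hs ⟨v, j⟩ (Finset.mem_univ _)]
      simp [hin, hs₁]
  exact Prod.ext hs₁ (funext fun e => hout e.1 e.2)

theorem exists_mem_states_fst_eq (hG : G.IsAcyclic) (c : LinearCode K G μ)
    (x : (Σ v, Fin (μ v)) → K) : ∃ s ∈ c.states, s.1 = x := by
  let source : c.states →ₗ[K] ((Σ v, Fin (μ v)) → K) := LinearMap.fst K _ _ ∘ₗ c.states.subtype
  have hinj : Function.Injective source :=
    LinearMap.ker_eq_bot.1 <| (Submodule.eq_bot_iff _).2 fun s hs =>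
      Subtype.ext (eq_zero_of_mem_states hG s.2 hs)
  have hdim : Module.finrank K c.states = Module.finrank K ((Σ v, Fin (μ v)) → K) := by
    refine (LinearMap.finrank_le_finrank_of_injective hinj).antisymm ?_
    have h := finrank_le_finrank_inf_iInf_ker_add_card (⊤ : Submodule K (G.State K μ))
      ((G.gates K μ).codingForm c.coeff) Finset.univ
    rw [top_inf_eq, finrank_top, Module.finrank_prod,
      Module.finrank_fintype_fun_eq_card K (η := G.OutPort)] at h
    exact Nat.le_of_add_le_add_right h
  obtain ⟨s, hs⟩ :=
    (LinearMap.injective_iff_surjective_of_finrank_eq_finrank hdim).1 hinj x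
  exact ⟨s, s.2, hs⟩

end LinearCode

theorem solvable_multipleMulticast_iff (hG : G.IsAcyclic) {S T : Finset V} :
    G.Solvable K μ (multipleMulticast μ S T) ↔ ∃ c : LinearCode K G μ, ∀ t ∈ T, ∀ s ∈ c.states,
      (∀ i, G.inMap K s.2 ⟨t, i⟩ = 0) → ∀ p, p.1 ∈ S → s.1 p = 0 := by
  constructor
  · rintro ⟨c, hc⟩
    refine ⟨c, fun t ht s hs hst p hp => ?_⟩
    have hdecode := (hc s.1).2 _ s.2 ((c.carries_iff _ _ _).2 ⟨rfl, hs⟩)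
      ⟨p.1, t, Finset.univ⟩ ⟨hp, ht, rfl⟩ p.2 (Finset.mem_univ _)
    simpa [LinearCode.decode, hst] using hdecode.symm
  · rintro ⟨c, hc⟩
    have hdecoder (t : V) (p : Σ v, Fin (μ v)) : ∃ ε : Fin (G.numIn t) → K, t ∈ T → p.1 ∈ S →
        ∀ s ∈ c.states, ∑ i, ε i * G.inMap K s.2 ⟨t, i⟩ = s.1 p := by
      by_cases htp : t ∈ T ∧ p.1 ∈ S
      · obtain ⟨ε, hε⟩ := exists_sum_mul_eq_of_forall_eq_zero c.states
          (fun i => LinearMap.proj (⟨t, i⟩ : G.InPort) ∘ₗ G.inMap K ∘ₗ LinearMap.snd K _ _)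
          (LinearMap.proj p ∘ₗ LinearMap.fst K _ _) fun s hs hst => hc t htp.1 s hs hst p htp.2
        exact ⟨ε, fun _ _ => hε⟩
      · exact ⟨0, fun ht hp => absurd ⟨ht, hp⟩ htp⟩
    choose ε hε using hdecoder
    refine ⟨{ c with ε := fun t i p => ε t p i }, fun x => ⟨?_, ?_⟩⟩
    · obtain ⟨s, hs, rfl⟩ := c.exists_mem_states_fst_eq hG x
      exact ⟨_, s.2, (LinearCode.carries_iff _ _ _ _).2 ⟨rfl, hs⟩⟩
    · rintro yIn yOut hcarries ⟨v, t, procs⟩ ⟨hv, ht, -⟩ k -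
      obtain ⟨rfl, hs⟩ := (LinearCode.carries_iff _ _ _ _).1 hcarries
      exact hε t ⟨v, k⟩ ht hv _ hs

theorem card_filter_fst_mem [DecidableEq V] (Ω : Finset V) :
    (Finset.univ.filter fun e : G.OutPort => e.1 ∈ Ω).card = ∑ v ∈ Ω, G.numOut v := by
  rw [← card_sigma_fin_subtype, Fintype.card_subtype]

theorem satisfiesCutBound_of_solvable (hG : G.IsAcyclic) {S T : Finset V}
    (h : G.Solvable K μ (multipleMulticast μ S T)) {t : V} (ht : t ∈ T) :
    G.SatisfiesCutBound K μ S t := by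
  classical
  obtain ⟨c, hc⟩ := (solvable_multipleMulticast_iff hG).1 h
  intro Ω _ htΩ
  let U := Finset.univ.filter fun e : G.OutPort => e.1 ∈ Ω
  have hbot : G.cutSpace K μ S Ω ⊓ (G.gates K μ).coded c.coeff U = ⊥ := by
    refine (Submodule.eq_bot_iff _).2 ?_
    rintro s ⟨hcut, hcoded⟩
    obtain ⟨hx, hy, hin⟩ := mem_cutSpace.1 hcut
    have hs : s ∈ c.states := mem_coded_gates.2 fun e _ => by
      by_cases he : e.1 ∈ Ω
      · exact mem_coded_gates.1 hcoded e (by simpa [U] using he)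
      · simp [hy e he, hin ⟨e.1, _⟩ he, hx ⟨e.1, _⟩ fun _ => he]
    refine LinearCode.eq_zero_of_mem_states hG hs (funext fun p => ?_)
    by_cases hp : p.1 ∈ S
    · exact hc t ht s hs (fun i => hin ⟨t, i⟩ htΩ) p hp
    · exact hx p fun h => absurd h hp
  have hdim : Module.finrank K (G.cutSpace K μ S Ω) ≤ Module.finrank K
      ↥(G.cutSpace K μ S Ω ⊓ (G.gates K μ).coded c.coeff U) + U.card :=
    finrank_le_finrank_inf_iInf_ker_add_card _ _ U
  rw [hbot, finrank_bot, zero_add, card_filter_fst_mem] at hdim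
  have hcut := finrank_cutSpace (K := K) (μ := μ) (G := G) S Ω
  omega

end Code

section Sufficiency

variable {K V : Type*} [Field K] [Fintype V] {G : ADTNetwork V} {μ : V → ℕ} {S : Finset V} {t : V}

variable (K G μ S t) in
/-- The states in which only the sources of `S` are active and in which `t` receives nothing. -/
noncomputable def blindSpace : Submodule K (G.State K μ) :=
  (Submodule.pi {p | p.1 ∉ S} fun _ => ⊥).prod
    ((Submodule.pi {e' | e'.1 = t} fun _ => ⊥).comap (G.inMap K))

theorem mem_blindSpace {s : G.State K μ} :
    s ∈ G.blindSpace K μ S t ↔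
      (∀ p, p.1 ∉ S → s.1 p = 0) ∧ ∀ i, G.inMap K s.2 ⟨t, i⟩ = 0 := by
  simp only [blindSpace, Submodule.mem_prod, Submodule.mem_comap, Submodule.mem_pi,
    Set.mem_ofPred_eq, Submodule.mem_bot]
  refine and_congr_right fun _ => ⟨fun h i => h ⟨t, i⟩ rfl, ?_⟩
  rintro h ⟨_, i⟩ rfl
  exact h i

theorem SatisfiesCutBound.finrank_cutSpace_le (h : G.SatisfiesCutBound K μ S t) {Ω : Finset V}
    (ht : t ∉ Ω) : Module.finrank K (G.cutSpace K μ S Ω) ≤ ∑ v ∈ Ω, G.numOut v := by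
  classical
  have hrate : ∑ v ∈ S with v ∈ Ω, μ v ≤ G.cutValue K Ω := by
    by_cases hS : ∃ v ∈ S, v ∈ Ω
    · convert h Ω hS ht
    · rw [Finset.filter_false_of_mem (by simpa using hS), Finset.sum_empty]
      exact Nat.zero_le _
  have hcut := finrank_cutSpace (K := K) (μ := μ) (G := G) S Ω
  omega

open Classical in
theorem SatisfiesCutBound.finrank_blindSpace_inf_silent_le (h : G.SatisfiesCutBound K μ S t)
    (ht : t ∉ S) (A : Finset G.OutPort) :
    Module.finrank K ↥(G.blindSpace K μ S t ⊓ (G.gates K μ).silent (Finset.univ \ A)) ≤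
      A.card := by
  set M := G.blindSpace K μ S t ⊓ (G.gates K μ).silent (Finset.univ \ A) with hM
  -- A supernode other than `t` outside `Ω` has a silent port, which observes all its inputs.
  let Ω := Finset.univ.filter fun v => v ≠ t ∧ ∀ j, ⟨v, j⟩ ∈ A
  let B := A.filter fun e => e.1 ∉ Ω
  have hle : M ⊓ ⨅ e ∈ B, LinearMap.ker ((G.gates K μ).out e) ≤ G.cutSpace K μ S Ω := by
    rintro s ⟨⟨hblind, hsilent⟩, hB⟩
    rw [SetLike.mem_coe, mem_blindSpace] at hblind
    replace hB : ∀ e ∈ B, s.2 e = 0 := by simpa [gates] using hB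
    replace hsilent : ∀ e ∉ A, _ := fun e he => mem_silent_gates.1 hsilent e (by simpa using he)
    have hport {v : V} (hv : v ∉ Ω) (hvt : v ≠ t) : ∃ j, ⟨v, j⟩ ∉ A := by
      simpa [Ω, hvt] using hv
    refine mem_cutSpace.2 ⟨fun p hp => ?_, fun e he => ?_, fun e' he' => ?_⟩
    · by_cases hpS : p.1 ∈ S
      · obtain ⟨j, hj⟩ := hport (hp hpS) (ne_of_mem_of_not_mem hpS ht)
        exact (hsilent _ hj).2.2 p.2
      · exact hblind.1 p hpS
    · by_cases heA : e ∈ A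
      · exact hB e (Finset.mem_filter.2 ⟨heA, he⟩)
      · exact (hsilent e heA).1
    · obtain ⟨v, i⟩ := e'
      obtain rfl | hvt := eq_or_ne v t
      · exact hblind.2 i
      · obtain ⟨j, hj⟩ := hport he' hvt
        exact (hsilent _ hj).2.1 i
  have hcard : ∑ v ∈ Ω, G.numOut v + B.card ≤ A.card := by
    rw [← Finset.card_filter_add_card_filter_not (s := A) fun e => e.1 ∈ Ω, ← card_filter_fst_mem]
    refine Nat.add_le_add_right (Finset.card_le_card fun e he => ?_) _
    have he' : e.1 ≠ t ∧ ∀ j, ⟨e.1, j⟩ ∈ A := by simpa [Ω] using he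
    exact Finset.mem_filter.2 ⟨he'.2 e.2, (Finset.mem_filter.1 he).2⟩
  calc Module.finrank K M
      ≤ Module.finrank K ↥(M ⊓ ⨅ e ∈ B, LinearMap.ker ((G.gates K μ).out e)) + B.card :=
        finrank_le_finrank_inf_iInf_ker_add_card _ _ _
    _ ≤ Module.finrank K (G.cutSpace K μ S Ω) + B.card := by
        gcongr; exact Submodule.finrank_mono hle
    _ ≤ ∑ v ∈ Ω, G.numOut v + B.card := by
        gcongr; exact h.finrank_cutSpace_le (by simp [Ω])
    _ ≤ A.card := hcard

theorem exists_coeff_forall_blindSpace_inf_coded_eq_bot [Infinite K] {T : Finset V}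
    (hST : Disjoint S T) (hcut : ∀ t ∈ T, G.SatisfiesCutBound K μ S t) (Z : Finset K)
    (hZ : T.card < Z.card) :
    ∃ β, (∀ e i, β e i ∈ Z) ∧
      ∀ t ∈ T, G.blindSpace K μ S t ⊓ (G.gates K μ).coded β Finset.univ = ⊥ := by
  classical
  have hex (t : T) : ∃ β, Module.finrank K
      ↥(G.blindSpace K μ S t ⊓ (G.gates K μ).coded β Finset.univ) ≤ 0 :=
    (G.gates K μ).exists_finrank_inf_coded_le _ _ _ fun A _ => by
      rw [zero_add]
      exact (hcut t t.2).finrank_blindSpace_inf_silent_le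
        (Finset.disjoint_right.1 hST t.2) A
  obtain ⟨β, hβZ, hβ⟩ := (G.gates K μ).exists_common_finrank_inf_coded_le _ _ _ Z
    (by rwa [Fintype.card_coe]) hex
  exact ⟨β, hβZ, fun t ht => Submodule.finrank_eq_zero.1 (Nat.le_zero.1 (hβ ⟨t, ht⟩))⟩

theorem solvable_of_satisfiesCutBound {F : Type*} [Field F] (hG : G.IsAcyclic) {T : Finset V}
    (hST : Disjoint S T) (hF : (T.card : ℕ∞) < ENat.card F)
    (hcut : ∀ t ∈ T, G.SatisfiesCutBound F μ S t) :
    G.Solvable F μ (multipleMulticast μ S T) := by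
  classical
  let f := algebraMap F (AlgebraicClosure F)
  obtain ⟨Z, hZ⟩ : ∃ Z : Finset F, T.card < Z.card := by
    cases finite_or_infinite F
    · have := Fintype.ofFinite F
      exact ⟨Finset.univ, by simpa [ENat.card_eq_coe_fintype_card] using hF⟩
    · obtain ⟨Z, hZ⟩ := Infinite.exists_subset_card_eq F (T.card + 1)
      exact ⟨Z, by omega⟩
  obtain ⟨β, hβZ, hβ⟩ := exists_coeff_forall_blindSpace_inf_coded_eq_bot (K := AlgebraicClosure F)
    hST (fun t ht => (G.satisfiesCutBound_iff_of_algebra F _ μ S t).2 (hcut t ht))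
    (Z.map ⟨f, f.injective⟩) (by rwa [Finset.card_map])
  have hβF (e i) : ∃ b, f b = β e i := by
    obtain ⟨b, -, hb⟩ := Finset.mem_map.1 (hβZ e i)
    exact ⟨b, hb⟩
  choose b hb using hβF
  let c : LinearCode F G μ :=
    { α v k j := if v ∈ S then b ⟨v, j⟩ (Sum.inr k) else 0
      β v i j := b ⟨v, j⟩ (Sum.inl i)
      ε _ _ _ := 0 }
  refine (solvable_multipleMulticast_iff hG).2 ⟨c, fun t ht s hs hst p hp => ?_⟩
  let s' : G.State (AlgebraicClosure F) μ := (fun p => if p.1 ∈ S then f (s.1 p) else 0, f ∘ s.2)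
  have hin (e' : G.InPort) : G.inMap _ s'.2 e' = f (G.inMap F s.2 e') := (map_inMap f s.2 e').symm
  have hblind : s' ∈ G.blindSpace _ μ S t :=
    mem_blindSpace.2 ⟨fun p hp => if_neg hp, fun i => by rw [hin, hst, map_zero]⟩
  have hcoded : s' ∈ (G.gates _ μ).coded β Finset.univ := mem_coded_gates.2 fun e _ => by
    have hse := congrArg f (mem_coded_gates.1 hs e (Finset.mem_univ e))
    by_cases he : e.1 ∈ S <;>
      simpa [s', c, LinearCode.coeff, hin, hb, he] using hse
  have hzero : s' = 0 := by
    rw [← Submodule.mem_bot (AlgebraicClosure F), ← hβ t ht]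
    exact ⟨hblind, hcoded⟩
  have hp' : f (s.1 p) = 0 := by simpa [s', hp] using congrFun (congrArg Prod.fst hzero) p
  exact (map_eq_zero f).1 hp'

end Sufficiency

end ADTNetwork

theorem exists_finiteDimensional_extension_lt_enatCard (F : Type u) [Field F] (n : ℕ) :
    ∃ (K : Type u) (_ : Field K) (_ : Algebra F K) (_ : FiniteDimensional F K),
      (n : ℕ∞) < ENat.card K := by
  obtain ⟨Z, hZ⟩ := Infinite.exists_subset_card_eq (AlgebraicClosure F) (n + 1)
  let K := IntermediateField.adjoin F (Z : Set (AlgebraicClosure F))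
  refine ⟨K, inferInstance, inferInstance, ?_, ?_⟩
  · exact IntermediateField.finiteDimensional_adjoin fun z _ => Algebra.IsIntegral.isIntegral z
  · calc (n : ℕ∞) < (Z : Set (AlgebraicClosure F)).encard := by
          rw [Set.encard_coe_eq_coe_finsetCard, hZ]
          exact_mod_cast n.lt_succ_self
      _ ≤ (K : Set (AlgebraicClosure F)).encard :=
          Set.encard_le_encard (IntermediateField.subset_adjoin F _)
      _ = ENat.card K := rfl

theorem mainTheorem8_general {V : Type v} [Fintype V] {F : Type u} [Field F]
    (G : ADTNetwork V) (hG : G.IsAcyclic) (μ : V → ℕ) (S T : Finset V) (hST : Disjoint S T) :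
    ((∃ (K : Type u) (_ : Field K) (_ : Algebra F K) (_ : FiniteDimensional F K),
        G.Solvable K μ (ADTNetwork.multipleMulticast μ S T)) ↔
      ∀ t ∈ T, G.SatisfiesCutBound F μ S t) ∧
    ((T.card : ℕ∞) < ENat.card F →
      (G.Solvable F μ (ADTNetwork.multipleMulticast μ S T) ↔
        ∀ t ∈ T, G.SatisfiesCutBound F μ S t)) := by
  refine ⟨⟨?_, fun hcut => ?_⟩, fun hF => ⟨fun h t => ?_, ?_⟩⟩
  · rintro ⟨K, _, _, -, h⟩ t ht
    exact (G.satisfiesCutBound_iff_of_algebra F K μ S t).1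
      (ADTNetwork.satisfiesCutBound_of_solvable hG h ht)
  · obtain ⟨K, _, _, hfin, hK⟩ := exists_finiteDimensional_extension_lt_enatCard F T.card
    exact ⟨K, _, _, hfin, ADTNetwork.solvable_of_satisfiesCutBound hG hST hK fun t ht =>
      (G.satisfiesCutBound_iff_of_algebra F K μ S t).2 (hcut t ht)⟩
  · exact ADTNetwork.satisfiesCutBound_of_solvable hG h
  · exact ADTNetwork.solvable_of_satisfiesCutBound hG hST hF

theorem mainTheorem8 {V : Type v} [Fintype V] {F : Type u} [Field F] [Finite F]
    (G : ADTNetwork V) (hG : G.IsAcyclic) (μ : V → ℕ) (S T : Finset V) (hST : Disjoint S T)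
    (hμ : ∀ v, v ∉ S → μ v = 0) :
    ((∃ (K : Type u) (_ : Field K) (_ : Finite K) (_ : Algebra F K),
        G.Solvable K μ (ADTNetwork.multipleMulticast μ S T)) ↔
      ∀ t ∈ T, G.SatisfiesCutBound F μ S t) ∧
    (T.card < Nat.card F →
      (G.Solvable F μ (ADTNetwork.multipleMulticast μ S T) ↔
        ∀ t ∈ T, G.SatisfiesCutBound F μ S t)) := by
  obtain ⟨hext, hself⟩ := mainTheorem8_general G hG μ S T hST (F := F)
  refine ⟨Iff.trans ⟨?_, ?_⟩ hext, fun hq => hself ?_⟩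
  · exact fun ⟨K, hK, hfin, hAlg, h⟩ => ⟨K, hK, hAlg, inferInstance, h⟩
  · exact fun ⟨K, hK, hAlg, hfd, h⟩ => ⟨K, hK, Module.finite_of_finite F, hAlg, h⟩
  · rwa [ENat.card_eq_coe_natCard, Nat.cast_lt]
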